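/- For every $n\ge 1$ let $\boldsymbol d=\boldsymbol d^{(n)}=(d_1,\dots,d_n)$ be a sequence of non-negative integers with even sum $\ell=\sum_{i=1}^n d_i$. Let $\mathrm{CM}_n(\boldsymbol d)$ be the configuration model: the random multigraph on $[n]$ obtained by giving vertex $i$ exactly $d_i$ half-edges and pairing the $\ell$ half-edges by a uniformly random perfect matching. Let $n_2=\#\{i: d_i=2\}$ and $\ell_{\neq 2}=\sum_{i:\,d_i\neq 2}d_i$. A connected component of $\mathrm{CM}_n(\boldsymbol d)$ is called cyclic if all its vertices have degree $2$ (so a single vertex with a self-loop and two vertices joined by a double edge are included), and $C_n(j)$ denotes the number of cyclic components with exactly $j$ vertices. For $a>0$ let $$S_n^{(a)}(k)=\begin{cases}0 & \text{if } k\le a n_2/\ell_{\neq 2},\\ \sum_{j\in\mathbb N:\ a n_2/\ell_{\neq 2}\le j\le k} C_n(j) & \text{if } k> a n_2/\ell_{\neq 2}.\end{cases}$$ Suppose that $\ell_{\neq 2}/\ell\to 0$ and $\ell_{\neq 2}\to\infty$ as $n\to\infty$. Then, for every $0<a<t<\infty$, $$S_n^{(a)}\big(t n_2/\ell_{\neq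 2}\big)\ \overset{d}{\longrightarrow}\ \mathsf{Poi}\Big(\int_a^t\lambda(r)\,dr\Big),\qquad \lambda(r)=\frac{e^{-r/2}}{2r};$$ that is, the number of cyclic components with size in $[a n_2/\ell_{\neq 2},\,t n_2/\ell_{\neq 2}]$ converges in distribution to a Poisson random variable with mean $\int_a^t \frac{e^{-r/2}}{2r}\,dr$. -/

import Mathlib

open MeasureTheory ProbabilityTheory Filter Topology

/-- A degree sequence on the vertex set `Fin n`, with even total degree. -/
structure DegSeq (n : ℕ) where
  deg : Fin n → ℕ
  even_sum : Even (∑ i, deg i)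

namespace DegSeq

variable {n : ℕ} (D : DegSeq n)

/-- The total number `ℓ` of half-edges. -/
def ell : ℕ := ∑ i, D.deg i

/-- The number `n₂` of vertices of degree `2`. -/
def n2 : ℕ := (Finset.univ.filter fun i => D.deg i = 2).card

/-- The number of half-edges attached to vertices of degree different from `2`. -/
def ellNe2 : ℕ := ∑ i ∈ Finset.univ.filter (fun i => D.deg i ≠ 2), D.deg i

/-- Half-edges: the vertex `i` carries `D.deg i` of them. -/
abbrev HalfEdge : Type := Σ i : Fin n, Fin (D.deg i)

/-- Perfect matchings of the set of half-edges, as fixed-point-free involutions. -/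
def Pairing : Type :=
  {σ : Equiv.Perm D.HalfEdge // (∀ x, σ (σ x) = x) ∧ ∀ x, σ x ≠ x}

instance : Finite D.Pairing := by
  unfold Pairing
  infer_instance

instance : Nonempty D.Pairing := by
  obtain ⟨m, hm⟩ := D.even_sum
  have hc : Fintype.card D.HalfEdge = Fintype.card (Fin m × Bool) := by
    simp [HalfEdge, hm, mul_two]
  obtain ⟨e⟩ := Fintype.card_eq.mp hc
  refine ⟨⟨(e.trans ((Equiv.refl (Fin m)).prodCongr Equiv.boolNot)).trans e.symm, ?_, ?_⟩⟩
  · intro x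
    simp [Prod.map]
  · intro x hx
    have h := congrArg (fun y => (e y).2) hx
    simp at h

instance : MeasurableSpace D.Pairing := ⊤

/-- The law of the configuration model: a uniformly random perfect matching of the half-edges. -/
noncomputable def law : Measure D.Pairing := uniformOn Set.univ

instance : IsProbabilityMeasure D.law := by
  unfold law
  infer_instance

variable {D}

namespace Pairing

/-- The simple graph underlying the multigraph given by a pairing: distinct vertices are adjacent
when a half-edge of one is paired with a half-edge of the other. Self-loops and multiplicities of
edges, which are dropped here, do not affect the connected components. -/
def graph (σ : D.Pairing) : SimpleGraph (Fin n) where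
  Adj i j := i ≠ j ∧ ∃ x : D.HalfEdge, x.1 = i ∧ (σ.1 x).1 = j
  symm := ⟨by
    rintro i j ⟨hij, x, hx, hy⟩
    exact ⟨hij.symm, σ.1 x, hy, by rw [σ.2.1 x, hx]⟩⟩
  loopless := ⟨fun _ h => h.1 rfl⟩

/-- A connected component is cyclic if all its vertices have degree `2` in the multigraph
(a vertex with a self-loop and a pair of vertices joined by a double edge are included). -/
def IsCyclic (σ : D.Pairing) (c : σ.graph.ConnectedComponent) : Prop :=
  ∀ v ∈ c.supp, D.deg v = 2

/-- The number `C(k)` of cyclic components with exactly `k` vertices. -/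
noncomputable def cycleCount (σ : D.Pairing) (k : ℕ) : ℕ :=
  {c : σ.graph.ConnectedComponent | σ.IsCyclic c ∧ c.supp.ncard = k}.ncard

open Classical in
/-- The process `S^{(a)}(x)`: it is `0` for `x ≤ a n₂ / ℓ_{≠2}`, and otherwise the number of cyclic
components whose number of vertices lies in `[a n₂ / ℓ_{≠2}, x]`. -/
noncomputable def cycleProcess (a x : ℝ) (σ : D.Pairing) : ℕ :=
  if x ≤ a * D.n2 / D.ellNe2 then 0
  else ∑ j ∈ Finset.Icc ⌈a * D.n2 / D.ellNe2⌉₊ ⌊x⌋₊, σ.cycleCount j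

end Pairing

end DegSeq

/-- The intensity `λ(r) = e^{-r/2} / (2r)`. -/
noncomputable def cycleIntensity (r : ℝ) : ℝ := Real.exp (-r / 2) / (2 * r)

/-! The proof uses binomial moments. Write `N` for the number of vertices of degree 2, `m` for the
number of other half-edges, and `x = N / m`. A cyclic component is a minimal nonempty set of
degree-2 vertices that the matching never leaves. Given that `B` is such a set, the matching of the
remaining half-edges is again uniform, with `N` lowered by `|B|` and `m` unchanged. Marking one
component therefore expresses the moment of order `k + 1` through moments of order `k` of smaller
models (`sum_choose_succ`, `binomialMoment_succ`).

A set of `j` vertices closes up into a cycle in `2^(j-1) (j-1)!` ways (`connCount_eq`), so the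
expected number of `j`-cycles is `(1/(2j)) ∏ (2N-2i)/(2N+m-2i-1)`, with `i < j`. Each factor is
about `1 - m/(2N)`, so for `j ≈ r x` this is about `e^(-r/2)/(2j)`. Summing over the window gives a
Riemann sum of mesh `1/x` for `Λ = ∫ λ`.

Deleting `k` cycles of length at most `t x` removes a fraction at most `k t / m → 0` of the degree-2
vertices, so the same asymptotics hold at every stage of the recursion, and `binomialMoment_bounds`
squeezes the `k`-th moment to `Λ^k / k!`. Bonferroni's inequalities turn these limits into
convergence of the point probabilities, which on `ℕ` is weak convergence. -/

/-! ### Perfect matchings and their components -/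

/-- Perfect matchings of a type, as fixed-point-free involutions. -/
def PerfectMatching (H : Type) : Type :=
  {σ : Equiv.Perm H // (∀ x, σ (σ x) = x) ∧ ∀ x, σ x ≠ x}

namespace PerfectMatching

variable {H V : Type}

instance [Finite H] : Finite (PerfectMatching H) := by
  unfold PerfectMatching
  infer_instance

noncomputable instance [Finite H] : Fintype (PerfectMatching H) := Fintype.ofFinite _

@[ext]
theorem ext {σ τ : PerfectMatching H} (h : ∀ x, σ.1 x = τ.1 x) : σ = τ :=
  Subtype.ext (Equiv.ext h)

/-- The restriction of a perfect matching to an invariant set. -/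
def restrict (σ : PerfectMatching H) (p : H → Prop) (hp : ∀ x, p (σ.1 x) ↔ p x) :
    PerfectMatching {x // p x} :=
  ⟨σ.1.subtypePerm hp, fun x => Subtype.ext (σ.2.1 x), fun x hx =>
    σ.2.2 x (congrArg Subtype.val hx)⟩

open Classical in
/-- The perfect matching obtained by joining perfect matchings of a set and of its complement. -/
noncomputable def join (p : H → Prop) (τ : PerfectMatching {x // p x})
    (ρ : PerfectMatching {x // ¬ p x}) : PerfectMatching H :=
  ⟨Equiv.Perm.subtypeCongr τ.1 ρ.1, by
    intro x
    by_cases hx : p x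
    · rw [Equiv.Perm.subtypeCongr.left_apply _ _ hx, Equiv.Perm.subtypeCongr.left_apply_subtype,
        τ.2.1]
    · rw [Equiv.Perm.subtypeCongr.right_apply _ _ hx, Equiv.Perm.subtypeCongr.right_apply_subtype,
        ρ.2.1], by
    intro x
    by_cases hx : p x
    · rw [Equiv.Perm.subtypeCongr.left_apply _ _ hx]
      exact fun h => τ.2.2 _ (Subtype.ext h)
    · rw [Equiv.Perm.subtypeCongr.right_apply _ _ hx]
      exact fun h => ρ.2.2 _ (Subtype.ext h)⟩

theorem join_apply_pos (p : H → Prop) (τ : PerfectMatching {x // p x})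
    (ρ : PerfectMatching {x // ¬ p x}) (x : {x // p x}) : (join p τ ρ).1 x = τ.1 x := by
  classical
  exact Equiv.Perm.subtypeCongr.left_apply _ _ x.2

theorem join_apply_neg (p : H → Prop) (τ : PerfectMatching {x // p x})
    (ρ : PerfectMatching {x // ¬ p x}) (x : {x // ¬ p x}) : (join p τ ρ).1 x = ρ.1 x := by
  classical
  exact Equiv.Perm.subtypeCongr.right_apply _ _ x.2

theorem join_invariant (p : H → Prop) (τ : PerfectMatching {x // p x})
    (ρ : PerfectMatching {x // ¬ p x}) (x : H) : p ((join p τ ρ).1 x) ↔ p x := by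
  by_cases hx : p x
  · have := join_apply_pos p τ ρ ⟨x, hx⟩
    simp only at this
    rw [this]
    exact iff_of_true (τ.1 ⟨x, hx⟩).2 hx
  · have := join_apply_neg p τ ρ ⟨x, hx⟩
    simp only at this
    rw [this]
    exact iff_of_false (ρ.1 ⟨x, hx⟩).2 hx

/-- The number of perfect matchings of a set with `2 s` elements. -/
theorem card_eq [Finite H] {s : ℕ} (hs : Nat.card H = 2 * s) :
    Fintype.card (PerfectMatching H) = Nat.doubleFactorial (2 * s - 1) := by
  classical
  have := Fintype.ofFinite H
  rw [Nat.card_eq_fintype_card] at hs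
  have key : ∀ σ : Equiv.Perm H, ((∀ x, σ (σ x) = x) ∧ ∀ x, σ x ≠ x) ↔
      σ.cycleType = Multiset.replicate s 2 := by
    intro σ
    constructor
    · rintro ⟨h1, h2⟩
      have h3 : σ ^ 2 = 1 := by
        ext x
        simp [pow_two, h1]
      have h4 := Equiv.Perm.cycleType_of_pow_prime_eq_one h3
      have h5 := σ.sum_cycleType
      have h6 : σ.support = Finset.univ := by
        ext x
        simp [h2]
      rw [h6, Finset.card_univ, hs] at h5
      have h7 := congrArg Multiset.sum h4
      rw [h5, Multiset.sum_replicate, smul_eq_mul] at h7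
      rw [h4]
      congr 1
      omega
    · intro h
      have h3 : σ ^ 2 = 1 := by
        rw [Equiv.Perm.pow_prime_eq_one_iff, h]
        exact fun b hb => Multiset.eq_of_mem_replicate hb
      refine ⟨fun x => by simpa [pow_two] using congrArg (fun e : Equiv.Perm H => e x) h3, ?_⟩
      have h5 := σ.sum_cycleType
      rw [h, Multiset.sum_replicate, smul_eq_mul, mul_comm, ← hs] at h5
      have h6 := Finset.card_eq_iff_eq_univ _ |>.1 h5.symm
      intro x
      have : x ∈ σ.support := h6 ▸ Finset.mem_univ x
      simpa using this
  have h1 : Fintype.card (PerfectMatching H) =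
      (Finset.univ.filter fun σ : Equiv.Perm H => σ.cycleType = Multiset.replicate s 2).card := by
    rw [← Fintype.card_subtype, ← Nat.card_eq_fintype_card, ← Nat.card_eq_fintype_card]
    exact Nat.card_congr (Equiv.subtypeEquivRight key)
  rw [h1]
  have h2 := Equiv.Perm.card_of_cycleType_mul_eq (α := H) (Multiset.replicate s 2)
  have h3 : (∏ n ∈ (Multiset.replicate s 2).toFinset,
      (Multiset.count n (Multiset.replicate s 2)).factorial) = s.factorial := by
    rcases Nat.eq_zero_or_pos s with rfl | hs0
    · simp
    · rw [Multiset.toFinset_replicate, if_neg hs0.ne']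
      simp
  -- This is `(2s)! = (2s-1)!! (2s)!!`. At `s = 0` the truncated `2 * s - 1` is `0`, and `0!! = 1`
  -- is still the right count.
  have h4 : (2 * s).factorial = Nat.doubleFactorial (2 * s - 1) * (2 ^ s * s.factorial) := by
    rw [← Nat.doubleFactorial_two_mul]
    rcases Nat.eq_zero_or_pos s with rfl | hs0
    · simp
    · obtain ⟨r, hr⟩ : ∃ r, 2 * s = r + 1 := ⟨2 * s - 1, by omega⟩
      rw [hr, Nat.factorial_eq_mul_doubleFactorial, Nat.add_sub_cancel, mul_comm]
  have h5 : 0 < 2 ^ s * s.factorial := by positivity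
  rw [h3, if_pos, hs, Multiset.sum_replicate, Multiset.prod_replicate, h4, smul_eq_mul,
    mul_comm s 2, Nat.sub_self, Nat.factorial_zero, one_mul] at h2
  · exact Nat.eq_of_mul_eq_mul_right h5 h2
  · refine ⟨?_, ?_⟩
    · rw [hs, Multiset.sum_replicate, smul_eq_mul, mul_comm]
    · intro a ha
      rw [Multiset.eq_of_mem_replicate ha]

/-- A set of vertices is stable if the matching never leaves it. -/
abbrev Stable (v : H → V) (A : Finset V) (σ : PerfectMatching H) : Prop :=
  ∀ h, v (σ.1 h) ∈ A ↔ v h ∈ A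

/-- A set of vertices is a component if it is a minimal nonempty stable set. -/
def IsComp (v : H → V) (A : Finset V) (σ : PerfectMatching H) : Prop :=
  A.Nonempty ∧ Stable v A σ ∧ ∀ B ⊆ A, B.Nonempty → Stable v B σ → B = A

theorem Stable.of_imp {v : H → V} {A : Finset V} {σ : PerfectMatching H}
    (h : ∀ x, v x ∈ A → v (σ.1 x) ∈ A) : Stable v A σ :=
  fun x => ⟨fun hx => by simpa only [σ.2.1] using h _ hx, h x⟩

theorem Stable.inter [DecidableEq V] {v : H → V} {A B : Finset V} {σ : PerfectMatching H}
    (hA : Stable v A σ) (hB : Stable v B σ) : Stable v (A ∩ B) σ := fun x => by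
  simp only [Finset.mem_inter, hA x, hB x]

theorem Stable.sdiff [DecidableEq V] {v : H → V} {A B : Finset V} {σ : PerfectMatching H}
    (hA : Stable v A σ) (hB : Stable v B σ) : Stable v (A \ B) σ := fun x => by
  simp only [Finset.mem_sdiff, hA x, hB x]

theorem IsComp.eq_of_not_disjoint {v : H → V} {A B : Finset V} {σ : PerfectMatching H}
    (hA : IsComp v A σ) (hB : IsComp v B σ) (h : ¬ Disjoint A B) : A = B := by
  classical
  have hn : (A ∩ B).Nonempty := Finset.not_disjoint_iff_nonempty_inter.1 h
  have hs := hA.2.1.inter hB.2.1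
  rw [← hA.2.2 _ Finset.inter_subset_left hn hs]
  exact hB.2.2 _ Finset.inter_subset_right hn hs

/-- A stable subset of `A` containing `a` of least cardinality works: a smaller stable nonempty `C`
would either contain `a` itself or leave the smaller stable set `B \ C` containing `a`. -/
theorem Stable.exists_isComp {v : H → V} {A : Finset V} {σ : PerfectMatching H}
    (hA : Stable v A σ) {a : V} (ha : a ∈ A) : ∃ B ⊆ A, a ∈ B ∧ IsComp v B σ := by
  classical
  obtain ⟨B, hB, hmin⟩ := Finset.exists_min_image
    (A.powerset.filter fun B => a ∈ B ∧ Stable v B σ) Finset.card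
    ⟨A, by simpa [ha] using hA⟩
  simp only [Finset.mem_filter, Finset.mem_powerset] at hB hmin
  refine ⟨B, hB.1, hB.2.1, ⟨a, hB.2.1⟩, hB.2.2, fun C hC hCn hCs => ?_⟩
  by_cases haC : a ∈ C
  · exact Finset.eq_of_subset_of_card_le hC (hmin C ⟨hC.trans hB.1, haC, hCs⟩)
  · have h1 := hmin (B \ C) ⟨Finset.sdiff_subset.trans hB.1, by simp [haC, hB.2.1],
      hB.2.2.sdiff hCs⟩
    have h2 := Finset.card_sdiff_add_card_eq_card hC
    have h3 := hCn.card_pos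
    omega

theorem stable_restrict {v : H → V} {B : Finset V} {σ : PerfectMatching H} {p : H → Prop}
    (hp : ∀ x, p (σ.1 x) ↔ p x) (hB : ∀ x, v x ∈ B → p x) :
    Stable (fun x : {x // p x} => v x) B (σ.restrict p hp) ↔ Stable v B σ := by
  refine ⟨fun h x => ?_, fun h x => h x⟩
  by_cases hx : p x
  · exact h ⟨x, hx⟩
  · exact iff_of_false (fun h' => hx ((hp x).1 (hB _ h'))) (fun h' => hx (hB _ h'))

/-- Being a component depends only on the half-edges at `B`, so it may be tested after discarding an
invariant set of other half-edges. -/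
theorem isComp_restrict {v : H → V} {B : Finset V} {σ : PerfectMatching H} {p : H → Prop}
    (hp : ∀ x, p (σ.1 x) ↔ p x) (hB : ∀ x, v x ∈ B → p x) :
    IsComp (fun x : {x // p x} => v x) B (σ.restrict p hp) ↔ IsComp v B σ := by
  unfold IsComp
  rw [stable_restrict hp hB]
  refine and_congr_right fun _ => and_congr_right fun _ => forall_congr' fun C => ?_
  refine forall_congr' fun hC => ?_
  rw [stable_restrict hp fun x hx => hB x (hC hx)]

theorem Stable.not_mem {v : H → V} {A : Finset V} {σ : PerfectMatching H}
    (hA : Stable v A σ) (x : H) : ¬ v (σ.1 x) ∈ A ↔ ¬ v x ∈ A := not_congr (hA x)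

open Classical in
/-- The number of perfect matchings for which `A` is a component. -/
noncomputable def connCount [Finite H] (v : H → V) (A : Finset V) : ℕ :=
  (Finset.univ.filter fun σ : PerfectMatching H => IsComp v A σ).card

open Classical in
/-- Summing over the matchings with component `A`: choose the matching on `A` and on its
complement separately. -/
theorem sum_isComp [Finite H] (v : H → V) (A : Finset V) (G : PerfectMatching H → ℕ)
    (F : PerfectMatching {h // ¬ v h ∈ A} → ℕ)
    (hGF : ∀ σ (hs : Stable v A σ), IsComp v A σ →
      G σ = F (σ.restrict (fun h => ¬ v h ∈ A) hs.not_mem)) :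
    ∑ σ with IsComp v A σ, G σ =
      connCount (fun x : {h // v h ∈ A} => v x) A * ∑ ρ, F ρ := by
  unfold connCount
  rw [Finset.card_eq_sum_ones, Finset.sum_mul_sum, ← Finset.sum_product']
  refine Finset.sum_bij (fun σ hσ =>
    (σ.restrict (fun h => v h ∈ A) (Finset.mem_filter.1 hσ).2.2.1,
      σ.restrict (fun h => ¬ v h ∈ A) (Stable.not_mem (Finset.mem_filter.1 hσ).2.2.1))) ?_ ?_ ?_ ?_
  · intro σ hσ
    simp only [Finset.mem_product, Finset.mem_filter, Finset.mem_univ, true_and, and_true]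
    exact (isComp_restrict _ fun x hx => hx).2 (Finset.mem_filter.1 hσ).2
  · intro σ hσ τ hτ h
    rw [Prod.mk.injEq] at h
    ext x
    by_cases hx : v x ∈ A
    · exact congrArg (fun e : PerfectMatching {h // v h ∈ A} => (e.1 ⟨x, hx⟩ : H)) h.1
    · exact congrArg (fun e : PerfectMatching {h // ¬ v h ∈ A} => (e.1 ⟨x, hx⟩ : H)) h.2
  · rintro ⟨τ, ρ⟩ h
    simp only [Finset.mem_product, Finset.mem_filter, Finset.mem_univ, true_and, and_true] at h
    have hst : Stable v A (join _ τ ρ) := join_invariant (fun h => v h ∈ A) τ ρ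
    have h1 : (join _ τ ρ).restrict (fun h => v h ∈ A) hst = τ := by
      ext x
      exact join_apply_pos _ τ ρ x
    have h2 : (join _ τ ρ).restrict (fun h => ¬ v h ∈ A) hst.not_mem = ρ := by
      ext x
      exact join_apply_neg (fun h => v h ∈ A) τ ρ x
    refine ⟨join _ τ ρ, ?_, ?_⟩
    · simp only [Finset.mem_filter, Finset.mem_univ, true_and]
      rw [← isComp_restrict (p := fun h => v h ∈ A) hst fun x hx => hx, h1]
      exact h
    · exact Prod.ext h1 h2
  · intro σ hσ
    rw [one_mul]
    exact hGF σ (Finset.mem_filter.1 hσ).2.2.1 (Finset.mem_filter.1 hσ).2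

end PerfectMatching

/-! ### Counting the cycles on a given vertex set -/

/-- Matchings on `n + 1` vertices of degree 2 are sorted here by the component of a fixed vertex,
`j` being the number of its other vertices. In the induction, the term `j = 0` is `(2n+1)!!` and the
others add up to `2(n+1)(2n+1)!!`. -/
theorem sum_descFactorial_mul_doubleFactorial (n : ℕ) :
    ∑ j ∈ Finset.range (n + 1), n.descFactorial j * 2 ^ j * Nat.doubleFactorial (2 * (n - j) - 1) =
      Nat.doubleFactorial (2 * n + 1) := by
  induction n with
  | zero => simp
  | succ n ih =>
    rw [Finset.sum_range_succ']
    have h : ∀ j ∈ Finset.range (n + 1), (n + 1).descFactorial (j + 1) * 2 ^ (j + 1) *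
        Nat.doubleFactorial (2 * (n + 1 - (j + 1)) - 1) = 2 * (n + 1) *
        (n.descFactorial j * 2 ^ j * Nat.doubleFactorial (2 * (n - j) - 1)) := by
      intro j _
      rw [Nat.succ_descFactorial_succ, Nat.add_sub_add_right]
      ring
    rw [Finset.sum_congr rfl h, ← Finset.mul_sum, ih]
    have h2 : Nat.doubleFactorial (2 * (n + 1) + 1) =
        (2 * n + 3) * Nat.doubleFactorial (2 * n + 1) := by
      rw [show 2 * (n + 1) + 1 = (2 * n + 1) + 2 by ring, Nat.doubleFactorial_add_two]
    rw [h2]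
    simp only [Nat.descFactorial_zero, pow_zero, Nat.sub_zero]
    rw [show 2 * (n + 1) - 1 = 2 * n + 1 by omega]
    ring

theorem Finset.sum_powerset_mem_apply_card {V : Type*} [DecidableEq V] (A : Finset V) {a : V}
    (ha : a ∈ A) (f : ℕ → ℕ) :
    ∑ B ∈ A.powerset with a ∈ B, f B.card =
      ∑ j ∈ Finset.range A.card, (A.card - 1).choose j * f (j + 1) := by
  obtain ⟨A', haA', rfl⟩ : ∃ A', a ∉ A' ∧ insert a A' = A :=
    ⟨A.erase a, Finset.notMem_erase a A, Finset.insert_erase ha⟩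
  rw [Finset.sum_filter, Finset.sum_powerset_insert haA', Finset.sum_eq_zero, zero_add,
    Finset.card_insert_of_notMem haA', Nat.add_sub_cancel]
  · have : ∀ B ∈ A'.powerset, (if a ∈ insert a B then f (insert a B).card else 0) =
        f (B.card + 1) := by
      intro B hB
      rw [if_pos (Finset.mem_insert_self a B), Finset.card_insert_of_notMem fun h =>
        haA' (Finset.mem_powerset.1 hB h)]
    rw [Finset.sum_congr rfl this, Finset.sum_powerset_apply_card (fun j => f (j + 1))]
    simp
  · intro B hB
    rw [if_neg fun h => haA' (Finset.mem_powerset.1 hB h)]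

namespace PerfectMatching

variable {H V : Type}

theorem card_fibers [Finite H] {v : H → V} {A : Finset V}
    (hf : ∀ i ∈ A, Nat.card {h // v h = i} = 2) : Nat.card {h // v h ∈ A} = 2 * A.card := by
  classical
  have := Fintype.ofFinite H
  rw [Nat.card_eq_fintype_card, Fintype.card_subtype,
    Finset.card_eq_sum_card_fiberwise (f := v) (t := A) (by intro x hx; simpa using hx),
    Finset.sum_const_nat (m := 2), mul_comm]
  intro i hi
  rw [← hf i hi, Nat.card_eq_fintype_card, Fintype.card_subtype, Finset.filter_filter]
  congr 1
  ext x
  simp only [Finset.mem_filter, Finset.mem_univ, true_and, and_iff_right_iff_imp]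
  rintro rfl
  exact hi

theorem card_fibers_compl [Finite H] {v : H → V} {A : Finset V}
    (hf : ∀ i ∈ A, Nat.card {h // v h = i} = 2) :
    2 * A.card + Nat.card {h // ¬ v h ∈ A} = Nat.card H := by
  classical
  rw [← card_fibers hf, ← Nat.card_sum]
  exact Nat.card_congr (Equiv.sumCompl _)

theorem card_fiber_restrict {v : H → V} {p : H → Prop} {i : V} (hp : ∀ h, v h = i → p h) :
    Nat.card {x : {h // p h} // v x = i} = Nat.card {h // v h = i} :=
  Nat.card_congr (Equiv.subtypeSubtypeEquivSubtype fun {h} => hp h)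

theorem card_isComp [Finite H] {v : H → V} {B : Finset V} {s : ℕ}
    (hf : ∀ i ∈ B, Nat.card {h // v h = i} = 2) (hs : Nat.card H = 2 * s) :
    connCount v B = connCount (fun x : {h // v h ∈ B} => v x) B *
      Nat.doubleFactorial (2 * (s - B.card) - 1) := by
  classical
  have h := sum_isComp v B (fun _ => 1) (fun _ => 1) (fun _ _ _ => rfl)
  rw [← Finset.card_eq_sum_ones, ← Finset.card_eq_sum_ones, Finset.card_univ,
    card_eq (s := s - B.card)] at h
  · rw [← h]
    unfold connCount
    congr
  · have := card_fibers_compl hf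
    omega

/-- Each matching has exactly one component containing `a`, so summing over candidates for it counts
every matching once. -/
theorem sum_connCount [Finite H] [DecidableEq V] {v : H → V} {A : Finset V} (hv : ∀ h, v h ∈ A)
    {a : V} (ha : a ∈ A) :
    ∑ B ∈ A.powerset with a ∈ B, connCount v B = Fintype.card (PerfectMatching H) := by
  classical
  unfold connCount
  simp_rw [Finset.card_filter]
  rw [Finset.sum_comm, ← Finset.card_univ, Finset.card_eq_sum_ones]
  refine Finset.sum_congr rfl fun σ _ => ?_
  have hst : Stable v A σ := fun h => iff_of_true (hv _) (hv _)
  obtain ⟨B, hBA, haB, hB⟩ := hst.exists_isComp ha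
  rw [Finset.sum_eq_single_of_mem B, if_pos hB]
  · simp [hBA, haB]
  · intro C hC hCB
    refine if_neg fun hC' => hCB (hC'.eq_of_not_disjoint hB ?_)
    exact Finset.not_disjoint_iff.2 ⟨a, (Finset.mem_filter.1 hC).2, haB⟩

/-- The number of ways in which `j + 1` vertices of degree `2` can form a cycle. -/
theorem connCount_eq {j : ℕ} [Finite H] {v : H → V} {A : Finset V} (hv : ∀ h, v h ∈ A)
    (hf : ∀ i ∈ A, Nat.card {h // v h = i} = 2) (hA : A.card = j + 1) :
    connCount v A = 2 ^ j * j.factorial := by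
  classical
  induction j using Nat.strong_induction_on generalizing H v A with
  | _ n ih =>
    obtain ⟨a, ha⟩ : A.Nonempty := Finset.card_pos.1 (by omega)
    have hH : Nat.card H = 2 * (n + 1) := by
      rw [← hA, ← card_fibers hf]
      exact (Nat.card_congr (Equiv.subtypeUnivEquiv hv)).symm
    have h1 := sum_connCount hv ha
    rw [card_eq hH] at h1
    -- The expected number of matchings in which a given `k`-set is a component. Its values have the
    -- correct total by `h3`, and those for proper subsets of `A` are correct by induction, so the
    -- only remaining one, at `A`, is correct too.
    let g : ℕ → ℕ := fun k => 2 ^ (k - 1) * (k - 1).factorial *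
      Nat.doubleFactorial (2 * (n + 1 - k) - 1)
    have h2 := Finset.sum_powerset_mem_apply_card A ha g
    have h3 := sum_descFactorial_mul_doubleFactorial n
    have h4 : ∑ B ∈ A.powerset with a ∈ B, g B.card = Nat.doubleFactorial (2 * (n + 1) - 1) := by
      rw [h2, hA, show 2 * (n + 1) - 1 = 2 * n + 1 by omega, ← h3]
      refine Finset.sum_congr rfl fun j _ => ?_
      simp only [g, Nat.add_sub_cancel, Nat.descFactorial_eq_factorial_mul_choose,
        Nat.add_sub_add_right]
      ring
    have hmem : A ∈ A.powerset.filter (a ∈ ·) := by simp [ha]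
    have hg : g A.card = 2 ^ n * n.factorial := by simp [g, hA]
    rw [← h4, ← Finset.add_sum_erase _ _ hmem, ← Finset.add_sum_erase _ _ hmem, hg] at h1
    refine Nat.add_right_cancel (h1.trans ?_)
    congr 1
    refine Finset.sum_congr rfl fun B hB => ?_
    simp only [Finset.mem_erase, Finset.mem_filter, Finset.mem_powerset] at hB
    obtain ⟨hBA, hB, haB⟩ := hB
    have hlt : B.card < A.card := Finset.card_lt_card (hB.ssubset_of_ne hBA)
    have hpos : 0 < B.card := Finset.card_pos.2 ⟨a, haB⟩
    rw [card_isComp (fun i hi => hf i (hB hi)) hH,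
      ih (B.card - 1) (by omega) (fun x => x.2) (fun i hi => ?_) (by omega)]
    rw [card_fiber_restrict fun h hh => hh ▸ hi, hf i (hB hi)]

/-! ### Recursion for the binomial moments -/

open Classical in
/-- The number of components contained in `A` whose number of vertices lies in `W`. -/
noncomputable def compCount (v : H → V) (W : Finset ℕ) (A : Finset V)
    (σ : PerfectMatching H) : ℕ :=
  (A.powerset.filter fun B => B.card ∈ W ∧ IsComp v B σ).card

/-- Distinct components are disjoint, so those other than `B` lie in `A \ B` and survive the
restriction unchanged. -/
theorem compCount_restrict [DecidableEq V] {v : H → V} {W : Finset ℕ} {A B : Finset V}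
    {σ : PerfectMatching H} (hBA : B ⊆ A) (hBW : B.card ∈ W) (hB : IsComp v B σ) :
    compCount v W A σ = compCount (fun x : {h // ¬ v h ∈ B} => v x) W (A \ B)
      (σ.restrict (fun h => ¬ v h ∈ B) hB.2.1.not_mem) + 1 := by
  classical
  unfold compCount
  rw [← Finset.card_insert_of_notMem (a := B)]
  · congr 1
    ext C
    simp only [Finset.mem_filter, Finset.mem_powerset, Finset.mem_insert]
    constructor
    · rintro ⟨hCA, hCW, hC⟩
      by_cases hd : Disjoint C B
      · refine Or.inr ⟨Finset.subset_sdiff.2 ⟨hCA, hd⟩, hCW, ?_⟩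
        exact (isComp_restrict _ fun x hx => Finset.disjoint_left.1 hd hx).2 hC
      · exact Or.inl (hC.eq_of_not_disjoint hB hd)
    · rintro (rfl | ⟨hC, hCW, hCc⟩)
      · exact ⟨hBA, hBW, hB⟩
      · rw [Finset.subset_sdiff] at hC
        exact ⟨hC.1, hCW, (isComp_restrict _ fun x hx => Finset.disjoint_left.1 hC.2 hx).1 hCc⟩
  · simp only [Finset.mem_filter, Finset.mem_powerset, Finset.subset_sdiff, not_and]
    rintro ⟨_, h⟩
    exact absurd (disjoint_self.1 h) hB.1.ne_empty

/-- Removing one component expresses a binomial moment of the component count through binomial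
moments of smaller order. -/
theorem sum_choose_succ [Finite H] [DecidableEq V] (v : H → V) (W : Finset ℕ) (A : Finset V)
    (hf : ∀ i ∈ A, Nat.card {h // v h = i} = 2) (k : ℕ) :
    (k + 1) * ∑ σ : PerfectMatching H, (compCount v W A σ).choose (k + 1) =
      ∑ B ∈ A.powerset with B.card ∈ W ∧ B.Nonempty,
        2 ^ (B.card - 1) * (B.card - 1).factorial *
          ∑ ρ, (compCount (fun x : {h // ¬ v h ∈ B} => v x) W (A \ B) ρ).choose k := by
  classical
  -- With `c` components, `(k+1) C(c, k+1) = c C(c-1, k)`; the factor `c` becomes the choice of a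
  -- marked component `B`.
  have h1 : ∀ σ : PerfectMatching H, (k + 1) * (compCount v W A σ).choose (k + 1) =
      ∑ B ∈ A.powerset with B.card ∈ W ∧ B.Nonempty,
        if IsComp v B σ then (compCount v W A σ - 1).choose k else 0 := by
    intro σ
    rw [← Finset.sum_filter, Finset.sum_const, Finset.filter_filter]
    have : (A.powerset.filter fun B => (B.card ∈ W ∧ B.Nonempty) ∧ IsComp v B σ).card =
        compCount v W A σ := by
      unfold compCount
      congr 1
      ext B
      simp only [Finset.mem_filter]
      refine and_congr_right fun _ => ⟨fun h => ⟨h.1.1, h.2⟩, fun h => ⟨⟨h.1, h.2.1⟩, h.2⟩⟩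
    rw [this, smul_eq_mul]
    rcases Nat.eq_zero_or_pos (compCount v W A σ) with h | h
    · simp [h]
    · obtain ⟨m, hm⟩ := Nat.exists_eq_add_of_le' h
      rw [hm, Nat.add_sub_cancel, Nat.add_one_mul_choose_eq, mul_comm]
  rw [Finset.mul_sum, Finset.sum_congr rfl fun σ _ => h1 σ, Finset.sum_comm]
  refine Finset.sum_congr rfl fun B hB => ?_
  simp only [Finset.mem_filter, Finset.mem_powerset] at hB
  obtain ⟨hBA, hBW, hBn⟩ := hB
  have hc := hBn.card_pos
  rw [← Finset.sum_filter, sum_isComp v B _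
    (fun ρ => (compCount (fun x : {h // ¬ v h ∈ B} => v x) W (A \ B) ρ).choose k)]
  · congr 1
    refine connCount_eq (fun x => x.2) (fun i hi => ?_) (by omega)
    rw [card_fiber_restrict fun h hh => hh ▸ hi, hf i (hBA hi)]
  · intro σ hs hB
    rw [compCount_restrict hBA hBW hB, Nat.add_sub_cancel]

end PerfectMatching

/-! ### Expected number of cycles of a given length -/

/-- The expected number of cycles of length `j` among `N` vertices of degree `2` in the presence of
`m` further half-edges. -/
noncomputable def expectedCycles (N m j : ℕ) : ℝ :=
  (∏ i ∈ Finset.range j, ((2 * N - 2 * i : ℝ) / (2 * N + m - 2 * i - 1))) / (2 * j)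

theorem doubleFactorial_eq_prod_mul {s j : ℕ} (hj : j ≤ s) :
    (Nat.doubleFactorial (2 * s - 1) : ℝ) =
      (∏ i ∈ Finset.range j, (2 * s - 2 * i - 1 : ℝ)) * Nat.doubleFactorial (2 * (s - j) - 1) := by
  induction j with
  | zero => simp
  | succ j ih =>
    rw [ih (by omega), Finset.prod_range_succ, mul_assoc]
    congr 1
    obtain ⟨r, rfl⟩ : ∃ r, s = r + j + 1 := ⟨s - (j + 1), by omega⟩
    rw [show 2 * (r + j + 1 - j) - 1 = 2 * r + 1 by omega,
      show r + j + 1 - (j + 1) = r by omega]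
    -- At `r = 0` the exponent `2 * r - 1` is truncated, so the recursion of the double factorial
    -- does not apply; the last factor of the product is then `1`.
    rcases r with _ | r
    · simp
      ring
    · rw [show 2 * (r + 1) + 1 = (2 * r + 1) + 2 by ring, Nat.doubleFactorial_add_two,
        show 2 * (r + 1) - 1 = 2 * r + 1 by omega]
      push_cast
      ring

/-- The left side is the number of `j`-sets, times the cycles on each, times the fraction of
matchings containing a given cycle. -/
theorem expectedCycles_eq {N μ j : ℕ} (hj : 1 ≤ j) (hjN : j ≤ N) :
    (N.choose j : ℝ) * (2 ^ (j - 1) * (j - 1).factorial *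
      (Nat.doubleFactorial (2 * (N + μ - j) - 1) / Nat.doubleFactorial (2 * (N + μ) - 1) : ℝ)) =
      expectedCycles N (2 * μ) j := by
  unfold expectedCycles
  rw [Finset.prod_div_distrib]
  have h1 : (N.choose j : ℝ) * (2 ^ (j - 1) * (j - 1).factorial) * (2 * j) =
      ∏ i ∈ Finset.range j, (2 * N - 2 * i : ℝ) := by
    have h2 : (N.descFactorial j : ℝ) = ∏ i ∈ Finset.range j, (N - i : ℝ) := by
      rw [Nat.descFactorial_eq_prod_range, Nat.cast_prod]
      refine Finset.prod_congr rfl fun i hi => ?_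
      rw [Nat.cast_sub (by have := Finset.mem_range.1 hi; omega)]
    simp_rw [← mul_sub]
    rw [Finset.prod_mul_distrib, ← h2, Nat.descFactorial_eq_factorial_mul_choose]
    obtain ⟨i, rfl⟩ : ∃ i, j = i + 1 := ⟨j - 1, by omega⟩
    simp only [Nat.add_sub_cancel, Finset.prod_const, Finset.card_range, Nat.factorial_succ]
    push_cast
    ring
  have h3 := doubleFactorial_eq_prod_mul (s := N + μ) (j := j) (by omega)
  have h4 : ∏ i ∈ Finset.range j, (2 * (N + μ : ℕ) - 2 * i - 1 : ℝ) =
      ∏ i ∈ Finset.range j, (2 * N + (2 * μ : ℕ) - 2 * i - 1 : ℝ) :=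
    Finset.prod_congr rfl fun i _ => by push_cast; ring
  rw [h4] at h3
  rw [← h1, h3]
  have h5 : (Nat.doubleFactorial (2 * (N + μ - j) - 1) : ℝ) ≠ 0 := by
    exact_mod_cast (Nat.doubleFactorial_pos _).ne'
  have h6 : ∏ i ∈ Finset.range j, (2 * N + (2 * μ : ℕ) - 2 * i - 1 : ℝ) ≠ 0 := by
    intro h
    rw [h, zero_mul] at h3
    exact absurd h3 (by exact_mod_cast (Nat.doubleFactorial_pos _).ne')
  have h7 : (j : ℝ) ≠ 0 := by positivity
  field_simp

/-- Each factor is `1 - (m-1)/(2N+m-2i-1)`, and `1 + y ≤ e^y`. Replacing the denominator by the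
larger `2N₀+m-1` makes the bound uniform while vertices are being deleted. -/
theorem expectedCycles_le {N N₀ m j : ℕ} (hm : 1 ≤ m) (hjN : j ≤ N) (hN : N ≤ N₀) :
    expectedCycles N m j ≤ Real.exp (-((m - 1) / (2 * N₀ + m - 1) * j)) / (2 * j) := by
  unfold expectedCycles
  gcongr
  rw [show -((m - 1) / (2 * N₀ + m - 1) * j : ℝ) = j * -((m - 1) / (2 * N₀ + m - 1)) by ring,
    Real.exp_nat_mul]
  have hm' : (1 : ℝ) ≤ m := by exact_mod_cast hm
  have hN' : (N : ℝ) ≤ N₀ := by exact_mod_cast hN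
  have hi : ∀ i ∈ Finset.range j, (i : ℝ) + 1 ≤ N := fun i hi => by
    have := Finset.mem_range.1 hi
    exact_mod_cast (by omega : i + 1 ≤ N)
  calc _ ≤ ∏ i ∈ Finset.range j, Real.exp (-((m - 1) / (2 * N₀ + m - 1))) := by
        refine Finset.prod_le_prod (fun i h => ?_) (fun i h => ?_)
        · have := hi i h
          exact div_nonneg (by linarith) (by linarith)
        · have := hi i h
          have h0 : (0 : ℝ) ≤ i := i.cast_nonneg
          have h1 : (0 : ℝ) < 2 * N + m - 2 * i - 1 := by linarith
          calc (2 * N - 2 * i : ℝ) / (2 * N + m - 2 * i - 1)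
              = -((m - 1) / (2 * N + m - 2 * i - 1)) + 1 := by field_simp; ring
            _ ≤ Real.exp (-((m - 1) / (2 * N + m - 2 * i - 1))) := Real.add_one_le_exp _
            _ ≤ _ := by
              rw [Real.exp_le_exp, neg_le_neg_iff]
              exact div_le_div_of_nonneg_left (by linarith) h1 (by linarith)
    _ = _ := by simp

/-- The inverse of each factor is `1 + (m-1)/(2N-2i)`, at most `e^((m-1)/(2L))` because `N - i ≥ L`.
-/
theorem le_expectedCycles {N L m j : ℕ} (hm : 1 ≤ m) (hL : 1 ≤ L) (hN : L + j ≤ N) :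
    Real.exp (-((m - 1) / (2 * L) * j)) / (2 * j) ≤ expectedCycles N m j := by
  unfold expectedCycles
  gcongr
  rw [show -((m - 1) / (2 * L) * j : ℝ) = j * -((m - 1) / (2 * L)) by ring,
    Real.exp_nat_mul]
  have hm' : (1 : ℝ) ≤ m := by exact_mod_cast hm
  have hL' : (1 : ℝ) ≤ L := by exact_mod_cast hL
  have hN' : (L : ℝ) + j ≤ N := by exact_mod_cast hN
  have hi : ∀ i ∈ Finset.range j, (i : ℝ) ≤ j := fun i hi => by
    exact_mod_cast (Finset.mem_range.1 hi).le
  calc _ = ∏ i ∈ Finset.range j, Real.exp (-((m - 1) / (2 * L))) := by simp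
    _ ≤ _ := by
        refine Finset.prod_le_prod (fun i h => (Real.exp_pos _).le) (fun i h => ?_)
        have := hi i h
        have h1 : (0 : ℝ) < 2 * N - 2 * i := by linarith
        have h2 : (0 : ℝ) < 2 * N + m - 2 * i - 1 := by linarith
        rw [Real.exp_neg, inv_le_comm₀ (Real.exp_pos _) (by positivity), inv_div]
        calc (2 * N + m - 2 * i - 1 : ℝ) / (2 * N - 2 * i)
            = (m - 1) / (2 * N - 2 * i) + 1 := by rw [div_add_one h1.ne']; congr 1; ring
          _ ≤ (m - 1) / (2 * L) + 1 := by
            gcongr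
            linarith
          _ ≤ _ := Real.add_one_le_exp _

/-! ### Bounds for the binomial moments -/

namespace PerfectMatching

variable {H V : Type}

/-- The binomial moments of the number of components in `A` with number of vertices in `W`. -/
noncomputable def binomialMoment [Finite H] (v : H → V) (W : Finset ℕ) (A : Finset V) (k : ℕ) : ℝ :=
  (∑ σ : PerfectMatching H, ((compCount v W A σ).choose k : ℝ)) / Fintype.card (PerfectMatching H)

theorem card_sdiff_fibers [Finite H] [DecidableEq V] {v : H → V} {A B : Finset V}
    (hf : ∀ i ∈ A, Nat.card {h // v h = i} = 2) {μ : ℕ} (hH : Nat.card H = 2 * (A.card + μ))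
    (hB : B ⊆ A) : Nat.card {h // ¬ v h ∈ B} = 2 * ((A \ B).card + μ) := by
  have h1 := card_fibers_compl (v := v) (A := B) fun i hi => hf i (hB hi)
  have h2 := Finset.card_sdiff_add_card_eq_card hB
  omega

theorem card_pos_of_even [Finite H] {s : ℕ} (hs : Nat.card H = 2 * s) :
    (0 : ℝ) < Fintype.card (PerfectMatching H) := by
  rw [card_eq hs]
  exact_mod_cast Nat.doubleFactorial_pos _

theorem binomialMoment_zero [Finite H] {v : H → V} {W : Finset ℕ} {A : Finset V} {s : ℕ}
    (hs : Nat.card H = 2 * s) : binomialMoment v W A 0 = 1 := by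
  have := card_pos_of_even hs
  simp [binomialMoment, this.ne']

/-- Each weight is the probability that `B` is a component, and the moment multiplying it belongs to
the uniform matching of what remains. -/
theorem binomialMoment_succ [Finite H] [DecidableEq V] {v : H → V} {W : Finset ℕ} {A : Finset V}
    (hf : ∀ i ∈ A, Nat.card {h // v h = i} = 2) {μ : ℕ} (hH : Nat.card H = 2 * (A.card + μ))
    (k : ℕ) :
    (k + 1) * binomialMoment v W A (k + 1) =
      ∑ B ∈ A.powerset with B.card ∈ W ∧ B.Nonempty,
        2 ^ (B.card - 1) * (B.card - 1).factorial *
          (Nat.doubleFactorial (2 * (A.card + μ - B.card) - 1) /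
            Nat.doubleFactorial (2 * (A.card + μ) - 1) : ℝ) *
          binomialMoment (fun x : {h // ¬ v h ∈ B} => v x) W (A \ B) k := by
  have h := congrArg (Nat.cast (R := ℝ)) (sum_choose_succ v W A hf k)
  push_cast at h
  unfold binomialMoment
  rw [← mul_div_assoc, h, Finset.sum_div, card_eq hH]
  refine Finset.sum_congr rfl fun B hB => ?_
  have hBA : B ⊆ A := Finset.mem_powerset.1 (Finset.mem_filter.1 hB).1
  rw [card_eq (card_sdiff_fibers hf hH hBA)]
  have h2 := Finset.card_sdiff_add_card_eq_card hBA
  rw [show (A \ B).card + μ = A.card + μ - B.card by omega]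
  have h5 : (Nat.doubleFactorial (2 * (A.card + μ - B.card) - 1) : ℝ) ≠ 0 := by
    exact_mod_cast (Nat.doubleFactorial_pos _).ne'
  field_simp

theorem sum_weights [DecidableEq V] {W : Finset ℕ} {A : Finset V} {μ : ℕ}
    (hW : ∀ j ∈ W, 1 ≤ j ∧ j ≤ A.card) :
    ∑ B ∈ A.powerset with B.card ∈ W ∧ B.Nonempty,
        2 ^ (B.card - 1) * (B.card - 1).factorial *
          (Nat.doubleFactorial (2 * (A.card + μ - B.card) - 1) /
            Nat.doubleFactorial (2 * (A.card + μ) - 1) : ℝ) =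
      ∑ j ∈ W, expectedCycles A.card (2 * μ) j := by
  have h1 : A.powerset.filter (fun B => B.card ∈ W ∧ B.Nonempty) =
      A.powerset.filter fun B => B.card ∈ W := by
    refine Finset.filter_congr fun B _ => and_iff_left_of_imp fun h => ?_
    exact Finset.card_pos.1 (hW _ h).1
  rw [h1, Finset.sum_filter, Finset.sum_powerset_apply_card (fun j => if j ∈ W then
    2 ^ (j - 1) * (j - 1).factorial *
          (Nat.doubleFactorial (2 * (A.card + μ - j) - 1) /
            Nat.doubleFactorial (2 * (A.card + μ) - 1) : ℝ) else 0)]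
  simp_rw [smul_ite, smul_zero]
  rw [← Finset.sum_filter]
  have h2 : (Finset.range (A.card + 1)).filter (· ∈ W) = W := by
    ext j
    simp only [Finset.mem_filter, Finset.mem_range, and_iff_right_iff_imp]
    exact fun h => Nat.lt_succ_of_le (hW j h).2
  rw [h2]
  refine Finset.sum_congr rfl fun j hj => ?_
  rw [nsmul_eq_mul, expectedCycles_eq (hW j hj).1 (hW j hj).2]

/-- Two-sided bounds for the binomial moments of the number of cyclic components. -/
theorem binomialMoment_bounds [DecidableEq V] {W : Finset ℕ} {K L N₀ μ : ℕ}
    (hW : ∀ j ∈ W, 1 ≤ j ∧ j ≤ K) (hμ : 1 ≤ μ) (hL : 1 ≤ L) (k : ℕ) [Finite H] (v : H → V)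
    (A : Finset V) (hf : ∀ i ∈ A, Nat.card {h // v h = i} = 2)
    (hH : Nat.card H = 2 * (A.card + μ)) (hA : A.card ≤ N₀) (hLA : L + k * K ≤ A.card) :
    (∑ j ∈ W, Real.exp (-(((2 * μ : ℕ) - 1) / (2 * L) * j)) / (2 * j)) ^ k / k.factorial ≤
        binomialMoment v W A k ∧
      binomialMoment v W A k ≤
        (∑ j ∈ W, Real.exp (-(((2 * μ : ℕ) - 1) / (2 * N₀ + (2 * μ : ℕ) - 1) * j)) / (2 * j)) ^ k /
          k.factorial := by
  induction k generalizing H v A with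
  | zero => simp [binomialMoment_zero hH]
  | succ k ih =>
    have hKA : K + (L + k * K) ≤ A.card := by
      rw [Nat.succ_mul] at hLA
      omega
    have hrec := binomialMoment_succ (W := W) hf hH k
    have hsum := sum_weights (W := W) (A := A) (μ := μ) fun j hj =>
      ⟨(hW j hj).1, (hW j hj).2.trans (by omega)⟩
    set lo := ∑ j ∈ W, Real.exp (-(((2 * μ : ℕ) - 1) / (2 * L) * j)) / (2 * j : ℝ) with hlo
    set hi := ∑ j ∈ W, Real.exp (-(((2 * μ : ℕ) - 1) / (2 * N₀ + (2 * μ : ℕ) - 1) * j)) /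
      (2 * j : ℝ) with hhi
    have hlo0 : 0 ≤ lo := Finset.sum_nonneg fun j _ => by positivity
    have hhi0 : 0 ≤ hi := Finset.sum_nonneg fun j _ => by positivity
    have hlow : lo ≤ ∑ j ∈ W, expectedCycles A.card (2 * μ) j :=
      Finset.sum_le_sum fun j hj => le_expectedCycles (by omega) hL
        (by have := (hW j hj).2; have := Nat.zero_le (k * K); omega)
    have hhigh : ∑ j ∈ W, expectedCycles A.card (2 * μ) j ≤ hi :=
      Finset.sum_le_sum fun j hj => expectedCycles_le (by omega)
        (by have := (hW j hj).2; omega) hA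
    -- Deleting `B` costs at most `K` vertices and leaves `μ` alone, so the slack `L + k * K`
    -- survives and the same `lo` and `hi` serve at every stage.
    have hB : ∀ B ∈ A.powerset.filter (fun B => B.card ∈ W ∧ B.Nonempty),
        lo ^ k / k.factorial ≤ binomialMoment (fun x : {h // ¬ v h ∈ B} => v x) W (A \ B) k ∧
        binomialMoment (fun x : {h // ¬ v h ∈ B} => v x) W (A \ B) k ≤
          hi ^ k / k.factorial := by
      intro B hB
      simp only [Finset.mem_filter, Finset.mem_powerset] at hB
      obtain ⟨hBA, hBW, -⟩ := hB
      have h2 := Finset.card_sdiff_add_card_eq_card hBA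
      have h3 := (hW _ hBW).2
      refine ih _ (A \ B) (fun i hi => ?_) (card_sdiff_fibers hf hH hBA) (by omega) (by omega)
      rw [Finset.mem_sdiff] at hi
      rw [card_fiber_restrict fun h hh => hh ▸ hi.2, hf i hi.1]
    have hk : (0 : ℝ) < k + 1 := by positivity
    have hfac : ∀ x : ℝ, x ^ (k + 1) / (k + 1).factorial = x * (x ^ k / k.factorial) / (k + 1) := by
      intro x
      rw [Nat.factorial_succ]
      push_cast
      field_simp
      ring
    rw [hfac, hfac, div_le_iff₀ hk, le_div_iff₀ hk, mul_comm (binomialMoment v W A (k + 1)), hrec]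
    constructor
    · calc lo * (lo ^ k / k.factorial)
          ≤ (∑ j ∈ W, expectedCycles A.card (2 * μ) j) * (lo ^ k / k.factorial) := by gcongr
        _ ≤ _ := by
          rw [← hsum, Finset.sum_mul]
          refine Finset.sum_le_sum fun B h => ?_
          gcongr
          exact (hB B h).1
    · calc _ ≤ (∑ j ∈ W, expectedCycles A.card (2 * μ) j) * (hi ^ k / k.factorial) := by
            rw [← hsum, Finset.sum_mul]
            refine Finset.sum_le_sum fun B h => ?_
            gcongr
            exact (hB B h).2
        _ ≤ _ := by gcongr

end PerfectMatching

/-! ### Riemann sums for the intensity -/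

theorem cycleIntensity_antitoneOn : AntitoneOn cycleIntensity (Set.Ioi 0) := by
  intro x hx y hy hxy
  have hx' : 0 < x := hx
  have hy' : 0 < y := hy
  unfold cycleIntensity
  gcongr

theorem cycleIntensity_nonneg {x : ℝ} (hx : 0 < x) : 0 ≤ cycleIntensity x := by
  unfold cycleIntensity
  positivity

theorem continuousOn_cycleIntensity : ContinuousOn cycleIntensity (Set.Ioi 0) := by
  unfold cycleIntensity
  refine ContinuousOn.div (by fun_prop) (by fun_prop) fun x hx => ?_
  have hx' : 0 < x := hx
  positivity

theorem intervalIntegrable_cycleIntensity {u w : ℝ} (hu : 0 < u) (hw : 0 < w) :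
    IntervalIntegrable cycleIntensity volume u w :=
  (continuousOn_cycleIntensity.mono fun _ hx => (lt_min hu hw).trans_le hx.1).intervalIntegrable

theorem tendsto_integral_cycleIntensity {a t : ℝ} (ha : 0 < a) (ht : 0 < t) {u w : ℕ → ℝ}
    (hu : Tendsto u atTop (𝓝 a)) (hw : Tendsto w atTop (𝓝 t)) :
    Tendsto (fun n => ∫ r in u n..w n, cycleIntensity r) atTop
      (𝓝 (∫ r in a..t, cycleIntensity r)) := by
  have hcont : ∀ y, 0 < y → ContinuousAt (fun y => ∫ r in a..y, cycleIntensity r) y := fun y hy =>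
    (intervalIntegral.integral_hasDerivAt_right (intervalIntegrable_cycleIntensity ha hy)
      (continuousOn_cycleIntensity.stronglyMeasurableAtFilter isOpen_Ioi y hy)
      (continuousOn_cycleIntensity.continuousAt (Ioi_mem_nhds hy))).continuousAt
  have h := ((hcont t ht).tendsto.comp hw).sub ((hcont a ha).tendsto.comp hu)
  rw [intervalIntegral.integral_same, sub_zero] at h
  refine h.congr' ?_
  filter_upwards [hu.eventually (lt_mem_nhds ha), hw.eventually (lt_mem_nhds ht)] with n h1 h2
  exact intervalIntegral.integral_interval_sub_left (intervalIntegrable_cycleIntensity ha h2)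
    (intervalIntegrable_cycleIntensity ha h1)

/-- The intensity decreases, so the sum lies between an integral reaching one mesh step further
right and its first term, which vanishes, plus an integral. The endpoints of both integrals tend to
`a` and `t`. -/
theorem tendsto_sum_cycleIntensity {a t : ℝ} (ha : 0 < a) (hat : a < t) {x : ℕ → ℝ}
    (hx : Tendsto x atTop atTop) :
    Tendsto (fun n => ∑ j ∈ Finset.Icc ⌈a * x n⌉₊ ⌊t * x n⌋₊, cycleIntensity (j / x n) / x n) atTop
      (𝓝 (∫ r in a..t, cycleIntensity r)) := by
  have ht := ha.trans hat
  have hA : Tendsto (fun n => (⌈a * x n⌉₊ : ℝ) / x n) atTop (𝓝 a) :=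
    (tendsto_nat_ceil_mul_div_atTop ha.le).comp hx
  have hB : Tendsto (fun n => (⌊t * x n⌋₊ : ℝ) / x n) atTop (𝓝 t) :=
    (tendsto_nat_floor_mul_div_atTop ht.le).comp hx
  have hB' : Tendsto (fun n => ((⌊t * x n⌋₊ + 1 : ℕ) : ℝ) / x n) atTop (𝓝 t) := by
    have := hB.add (tendsto_inv_atTop_zero.comp hx)
    rw [add_zero] at this
    refine this.congr fun n => ?_
    push_cast
    rw [add_div, one_div]
    rfl
  have hlow := tendsto_integral_cycleIntensity ha ht hA hB'
  have hterm : Tendsto (fun n => cycleIntensity ((⌈a * x n⌉₊ : ℝ) / x n) / x n) atTop (𝓝 0) :=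
    ((continuousOn_cycleIntensity.continuousAt (Ioi_mem_nhds ha)).tendsto.comp hA).div_atTop hx
  have hhigh := hterm.add (tendsto_integral_cycleIntensity ha ht hA hB)
  rw [zero_add] at hhigh
  have hlarge : ∀ᶠ n in atTop, 0 < x n ∧ ⌈a * x n⌉₊ ≤ ⌊t * x n⌋₊ := by
    -- Once `(t - a) x ≥ 1`, the interval `[a x, t x]` contains an integer.
    filter_upwards [hx.eventually_gt_atTop 0, hx.eventually_ge_atTop (1 / (t - a))] with n h1 h2
    refine ⟨h1, Nat.le_floor ?_⟩
    have h3 := Nat.ceil_lt_add_one (mul_pos ha h1).le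
    rw [div_le_iff₀ (by linarith)] at h2
    linarith
  have hanti : ∀ n, 0 < x n → AntitoneOn (fun s : ℝ => cycleIntensity (s / x n) / x n)
      (Set.Ioi 0) := fun n hn s hs s' hs' h =>
    div_le_div_of_nonneg_right (cycleIntensity_antitoneOn (div_pos hs hn) (div_pos hs' hn)
      (div_le_div_of_nonneg_right h hn.le)) hn.le
  have hint : ∀ n, 0 < x n → ∀ b c : ℝ, ∫ s in b..c, cycleIntensity (s / x n) / x n =
      ∫ r in b / x n..c / x n, cycleIntensity r := fun n hn b c => by
    rw [intervalIntegral.integral_div, intervalIntegral.integral_comp_div _ hn.ne', smul_eq_mul,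
      mul_div_cancel_left₀ _ hn.ne']
  refine tendsto_of_tendsto_of_tendsto_of_le_of_le' hlow hhigh ?_ ?_
  · filter_upwards [hlarge] with n ⟨hn, hAB⟩
    have hA0 : 0 < ⌈a * x n⌉₊ := Nat.ceil_pos.2 (mul_pos ha hn)
    rw [← hint n hn, ← Finset.Ico_succ_right_eq_Icc]
    refine AntitoneOn.integral_le_sum_Ico (f := fun s : ℝ => cycleIntensity (s / x n) / x n)
      (hAB.trans (Nat.le_succ _)) ((hanti n hn).mono fun s hs => ?_)
    exact (Nat.cast_pos.2 hA0).trans_le hs.1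
  · filter_upwards [hlarge] with n ⟨hn, hAB⟩
    have hA0 : 0 < ⌈a * x n⌉₊ := Nat.ceil_pos.2 (mul_pos ha hn)
    rw [← hint n hn, ← Finset.add_sum_Ioc_eq_sum_Icc hAB]
    refine add_le_add_right ?_ _
    have h := AntitoneOn.sum_le_integral_Ico
      (f := fun s : ℝ => cycleIntensity (s / x n) / x n) hAB ((hanti n hn).mono fun s hs =>
        (Nat.cast_pos.2 hA0).trans_le hs.1)
    refine le_trans (le_of_eq ?_) h
    rw [Finset.sum_Ico_add' (fun i : ℕ => cycleIntensity (i / x n) / x n)]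
    congr 1
    ext i
    simp only [Finset.mem_Ioc, Finset.mem_Ico]
    omega

theorem abs_exp_neg_sub_exp_neg_le {u w : ℝ} (hu : 0 ≤ u) (hw : 0 ≤ w) :
    |Real.exp (-u) - Real.exp (-w)| ≤ |u - w| := by
  wlog h : u ≤ w generalizing u w
  · rw [abs_sub_comm, abs_sub_comm u]
    exact this hw hu (le_of_not_ge h)
  rw [abs_of_nonneg (sub_nonneg.2 (Real.exp_le_exp.2 (neg_le_neg h))), abs_sub_comm,
    abs_of_nonneg (sub_nonneg.2 h)]
  have h1 : Real.exp (-w) = Real.exp (-u) * Real.exp (-(w - u)) := by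
    rw [← Real.exp_add]
    congr 1
    ring
  have h2 := Real.add_one_le_exp (-(w - u))
  have h3 : Real.exp (-u) ≤ 1 := Real.exp_le_one_iff.2 (by linarith)
  have h4 := Real.exp_pos (-u)
  rw [h1]
  nlinarith

/-- Replacing `θ` by `1/(2x)` changes each term by at most `|θ x - 1/2| / (2x)`, since `e^(-u)` is
1-Lipschitz on `u ≥ 0`. There are at most `t x` terms, and the Riemann sum remains. -/
theorem tendsto_sum_exp_div {a t : ℝ} (ha : 0 < a) (hat : a < t) {x θ : ℕ → ℝ}
    (hx : Tendsto x atTop atTop) (hθ : Tendsto (fun n => θ n * x n) atTop (𝓝 (1 / 2))) :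
    Tendsto (fun n => ∑ j ∈ Finset.Icc ⌈a * x n⌉₊ ⌊t * x n⌋₊,
      Real.exp (-(θ n * j)) / (2 * j : ℝ)) atTop (𝓝 (∫ r in a..t, cycleIntensity r)) := by
  have h1 := tendsto_sum_cycleIntensity ha hat hx
  have ht := ha.trans hat
  have h2 : Tendsto (fun n => t / 2 * |θ n * x n - 1 / 2|) atTop (𝓝 0) := by
    have := ((hθ.sub_const (1 / 2)).abs).const_mul (t / 2)
    simpa using this
  rw [← zero_add (∫ r in a..t, cycleIntensity r)]
  refine ((squeeze_zero_norm' ?_ h2).add h1).congr fun n => sub_add_cancel _ _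
  filter_upwards [hx.eventually_gt_atTop 0,
    hθ.eventually (lt_mem_nhds (by norm_num : (0 : ℝ) < 1 / 2))] with n hn hθn
  have hθ0 : 0 ≤ θ n := (pos_of_mul_pos_left hθn hn.le).le
  rw [← Finset.sum_sub_distrib]
  have hA0 : 0 < ⌈a * x n⌉₊ := Nat.ceil_pos.2 (mul_pos ha hn)
  refine (norm_sum_le_of_le (n := fun _ => |θ n * x n - 1 / 2| / (2 * x n)) _ fun j hj => ?_).trans ?_
  · have hj0 : (0 : ℝ) < j := Nat.cast_pos.2 (hA0.trans_le (Finset.mem_Icc.1 hj).1)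
    have h3 : cycleIntensity (j / x n) / x n = Real.exp (-(j / (2 * x n))) / (2 * j) := by
      unfold cycleIntensity
      rw [show -((j : ℝ) / x n) / 2 = -(j / (2 * x n)) by field_simp]
      field_simp
    have h4 := abs_exp_neg_sub_exp_neg_le (u := θ n * j) (w := j / (2 * x n)) (by positivity)
      (by positivity)
    have h5 : θ n * j - j / (2 * x n) = j / x n * (θ n * x n - 1 / 2) := by
      field_simp
    rw [h5, abs_mul, abs_of_pos (div_pos hj0 hn)] at h4
    rw [h3, ← sub_div, Real.norm_eq_abs, abs_div, abs_of_pos (by positivity : (0 : ℝ) < 2 * j),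
      div_le_iff₀ (by positivity)]
    refine h4.trans (le_of_eq ?_)
    field_simp
  · rw [Finset.sum_const, nsmul_eq_mul, Nat.card_Icc]
    have h3 : ((⌊t * x n⌋₊ + 1 - ⌈a * x n⌉₊ : ℕ) : ℝ) ≤ t * x n :=
      (Nat.cast_le.2 (by omega)).trans (Nat.floor_le (mul_pos ht hn).le)
    calc _ ≤ t * x n * (|θ n * x n - 1 / 2| / (2 * x n)) := by gcongr
      _ = _ := by field_simp

/-! ### From binomial moments to weak convergence -/

/-- Bonferroni's inequalities for the indicator of `y = k`. -/
theorem abs_indicator_sub_sum_choose_le (k R y : ℕ) :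
    |(if y = k then 1 else 0 : ℝ) -
        ∑ s ∈ Finset.range (R + 1), (-1) ^ s * ((k + s).choose k : ℝ) * (y.choose (k + s) : ℝ)| ≤
      ((k + (R + 1)).choose k : ℝ) * (y.choose (k + (R + 1)) : ℝ) := by
  rcases lt_trichotomy y k with h | rfl | h
  · rw [if_neg h.ne, Finset.sum_eq_zero]
    · simp
      positivity
    · intro s _
      rw [Nat.choose_eq_zero_of_lt (by omega : y < k + s)]
      simp
  · rw [if_pos rfl, Finset.sum_range_succ', Finset.sum_eq_zero]
    · simp
      positivity
    · intro s _
      rw [Nat.choose_eq_zero_of_lt (by omega : y < y + (s + 1))]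
      simp
  · obtain ⟨m, rfl⟩ : ∃ m, y = k + (m + 1) := ⟨y - k - 1, by omega⟩
    have hc : ∀ s, ((k + s).choose k : ℝ) * ((k + (m + 1)).choose (k + s) : ℝ) =
        ((k + (m + 1)).choose k : ℝ) * ((m + 1).choose s : ℝ) := by
      intro s
      rcases le_or_gt s (m + 1) with hs | hs
      · have := Nat.choose_mul (n := k + (m + 1)) (k := k + s) (s := k) (by omega)
        rw [Nat.add_sub_cancel_left, Nat.add_sub_cancel_left] at this
        rw [mul_comm]
        exact_mod_cast this
      · rw [Nat.choose_eq_zero_of_lt hs, Nat.choose_eq_zero_of_lt (by omega : k + (m + 1) < k + s)]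
        simp
    -- After factoring out `C(y, k)`, the truncated alternating sum collapses to `± C(m, R)`, which
    -- is at most `C(m+1, R+1)`, the first omitted term.
    have hsum : ∑ s ∈ Finset.range (R + 1), (-1 : ℝ) ^ s * ((m + 1).choose s : ℝ) =
        (-1) ^ R * m.choose R := by
      exact_mod_cast congrArg (Int.cast (R := ℝ))
        (Int.alternating_sum_range_choose_eq_choose (n := m) (m := R))
    simp_rw [mul_assoc, hc]
    rw [if_neg (by omega), zero_sub, abs_neg]
    simp_rw [mul_left_comm _ ((k + (m + 1)).choose k : ℝ)]
    rw [← Finset.mul_sum, hsum, abs_mul, abs_mul, abs_pow, abs_neg, abs_one, one_pow, one_mul,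
      Nat.abs_cast, Nat.abs_cast, Nat.choose_succ_succ m R]
    gcongr
    omega

/-- Convergence of all binomial moments to those of a Poisson law implies convergence of the
point probabilities. -/
theorem tendsto_card_div_of_binomialMoments {Ω : ℕ → Type} [∀ n, Fintype (Ω n)]
    [∀ n, Nonempty (Ω n)] (X : (n : ℕ) → Ω n → ℕ) (Λ : ℝ)
    (h : ∀ k, Tendsto (fun n => (∑ ω, ((X n ω).choose k : ℝ)) / Fintype.card (Ω n)) atTop
      (𝓝 (Λ ^ k / k.factorial))) (k : ℕ) :
    Tendsto (fun n => ((Finset.univ.filter fun ω => X n ω = k).card : ℝ) / Fintype.card (Ω n)) atTop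
      (𝓝 (Real.exp (-Λ) * Λ ^ k / k.factorial)) := by
  set b : ℕ → ℕ → ℝ := fun k n => (∑ ω, ((X n ω).choose k : ℝ)) / Fintype.card (Ω n) with hb
  have hcoef : ∀ s, ((k + s).choose k : ℝ) * (Λ ^ (k + s) / (k + s).factorial) =
      Λ ^ k / k.factorial * (Λ ^ s / s.factorial) := by
    intro s
    rw [Nat.cast_add_choose, pow_add]
    have := (k + s).factorial_ne_zero
    field_simp
  have hbound : ∀ R n,
      |((Finset.univ.filter fun ω => X n ω = k).card : ℝ) / Fintype.card (Ω n) -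
        ∑ s ∈ Finset.range (R + 1), (-1) ^ s * ((k + s).choose k : ℝ) * b (k + s) n| ≤
      ((k + (R + 1)).choose k : ℝ) * b (k + (R + 1)) n := by
    intro R n
    have hpos : (0 : ℝ) < Fintype.card (Ω n) := Nat.cast_pos.2 Fintype.card_pos
    have h1 : ∑ s ∈ Finset.range (R + 1), (-1) ^ s * ((k + s).choose k : ℝ) * b (k + s) n =
        (∑ ω, ∑ s ∈ Finset.range (R + 1), (-1) ^ s * ((k + s).choose k : ℝ) *
          ((X n ω).choose (k + s) : ℝ)) / Fintype.card (Ω n) := by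
      rw [Finset.sum_comm, Finset.sum_div]
      simp_rw [hb, ← Finset.mul_sum, mul_div_assoc]
    rw [h1, Finset.card_filter, ← sub_div, abs_div, abs_of_pos hpos, hb]
    simp only
    rw [← mul_div_assoc, Finset.mul_sum]
    push_cast
    rw [← Finset.sum_sub_distrib]
    gcongr
    exact (Finset.abs_sum_le_sum_abs _ _).trans
      (Finset.sum_le_sum fun ω _ => abs_indicator_sub_sum_choose_le k R _)
  have hlim1 : Tendsto (fun R => ∑ s ∈ Finset.range (R + 1),
      (-1 : ℝ) ^ s * ((k + s).choose k : ℝ) * (Λ ^ (k + s) / (k + s).factorial)) atTop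
      (𝓝 (Real.exp (-Λ) * Λ ^ k / k.factorial)) := by
    have h1 := (NormedSpace.expSeries_div_hasSum_exp (-Λ)).tendsto_sum_nat.comp
      (tendsto_add_atTop_nat 1)
    rw [← Real.exp_eq_exp_ℝ] at h1
    have h2 := h1.const_mul (Λ ^ k / k.factorial)
    rw [show Real.exp (-Λ) * Λ ^ k / k.factorial = Λ ^ k / k.factorial * Real.exp (-Λ) by ring]
    refine h2.congr fun R => ?_
    simp only [Function.comp_apply]
    rw [Finset.mul_sum]
    refine Finset.sum_congr rfl fun s _ => ?_
    rw [mul_assoc, hcoef, neg_pow]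
    ring
  have hlim2 : Tendsto (fun R => ((k + (R + 1)).choose k : ℝ) *
      (Λ ^ (k + (R + 1)) / (k + (R + 1)).factorial)) atTop (𝓝 0) := by
    simp_rw [hcoef]
    have := ((FloorSemiring.tendsto_pow_div_factorial_atTop Λ).comp
      (tendsto_add_atTop_nat 1)).const_mul (Λ ^ k / k.factorial)
    rw [mul_zero] at this
    exact this
  rw [Metric.tendsto_atTop']
  intro ε hε
  -- The truncation `R` is fixed before `n`, using only the limiting Poisson series; then just
  -- finitely many moments have to be close to their limits.
  obtain ⟨R, hR1, hR2⟩ := ((hlim1.eventually (Metric.ball_mem_nhds _ (by positivity : 0 < ε / 3))).and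
    (hlim2.eventually (gt_mem_nhds (by positivity : 0 < ε / 3)))).exists
  have hn1 : Tendsto (fun n => ∑ s ∈ Finset.range (R + 1), (-1) ^ s * ((k + s).choose k : ℝ) *
      b (k + s) n) atTop (𝓝 (∑ s ∈ Finset.range (R + 1),
      (-1 : ℝ) ^ s * ((k + s).choose k : ℝ) * (Λ ^ (k + s) / (k + s).factorial))) :=
    tendsto_finsetSum _ fun s _ => (h (k + s)).const_mul _
  have hn2 := (h (k + (R + 1))).const_mul ((k + (R + 1)).choose k : ℝ)
  have hev := (hn1.eventually (Metric.ball_mem_nhds _ (by positivity : 0 < ε / 3))).and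
    (hn2.eventually (gt_mem_nhds hR2))
  obtain ⟨n₀, hn₀⟩ := eventually_atTop.1 hev
  refine ⟨n₀, fun n hn => ?_⟩
  obtain ⟨h3, h4⟩ := hn₀ n hn.le
  have h5 := hbound R n
  rw [Real.dist_eq] at h3 hR1
  rw [Real.dist_eq]
  rw [abs_lt] at *
  rw [abs_le] at h5
  constructor <;> linarith [h3.1, h3.2, hR1.1, hR1.2, h5.1, h5.2]

/-- Probability measures on `ℕ` converge weakly if all point probabilities converge. -/
theorem tendsto_probabilityMeasure_nat {μ : ℕ → ProbabilityMeasure ℕ} {ν : ProbabilityMeasure ℕ}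
    (h : ∀ k, Tendsto (fun n => (μ n : Measure ℕ).real {k}) atTop
      (𝓝 ((ν : Measure ℕ).real {k}))) : Tendsto μ atTop (𝓝 ν) := by
  -- With the empty set added, the singletons form a π-system containing a neighbourhood base of the
  -- discrete space `ℕ`.
  refine IsPiSystem.tendsto_probabilityMeasure_of_tendsto_of_mem
    (S := insert ∅ (Set.range fun k : ℕ => ({k} : Set ℕ)))
    ?_ (fun _ _ => .of_discrete) ?_ ?_
  · rintro s (rfl | ⟨i, rfl⟩) t (rfl | ⟨j, rfl⟩) hst
    · simp at hst
    · simp at hst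
    · simp at hst
    · obtain ⟨x, hx1, hx2⟩ := hst
      rw [Set.mem_singleton_iff] at hx1 hx2
      subst hx1 hx2
      right
      exact ⟨x, by simp⟩
  · intro u _ x hx
    exact ⟨{x}, Or.inr ⟨x, rfl⟩, by simp, by simpa using hx⟩
  · rintro s (rfl | ⟨k, rfl⟩)
    · simp
    · rw [← NNReal.tendsto_coe]
      exact h k

/-! ### Cyclic components as minimal stable sets -/

namespace DegSeq

variable {n : ℕ} {D : DegSeq n}

theorem ell_eq : D.ell = 2 * D.n2 + D.ellNe2 := by
  unfold ell n2 ellNe2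
  rw [← Finset.sum_filter_add_sum_filter_not Finset.univ (fun i => D.deg i = 2)]
  congr 1
  rw [Finset.sum_const_nat (m := 2) fun i hi => (Finset.mem_filter.1 hi).2, mul_comm]

theorem card_halfEdge : Nat.card D.HalfEdge = D.ell := by
  simp [HalfEdge, ell, Nat.card_eq_fintype_card]

theorem card_fiber (i : Fin n) : Nat.card {h : D.HalfEdge // h.1 = i} = D.deg i := by
  rw [Nat.card_congr (Equiv.sigmaSubtype i), Nat.card_eq_fintype_card, Fintype.card_fin]

namespace Pairing

theorem mem_of_reachable {σ : D.Pairing} {B : Finset (Fin n)}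
    (hB : PerfectMatching.Stable (H := D.HalfEdge) Sigma.fst B σ) {v w : Fin n}
    (h : σ.graph.Reachable v w) (hv : v ∈ B) : w ∈ B := by
  obtain ⟨p⟩ := h
  induction p with
  | nil => exact hv
  | cons hadj _ ih =>
    obtain ⟨_, x, rfl, rfl⟩ := hadj
    exact ih ((hB x).2 hv)

open Classical in
theorem isComp_supp {σ : D.Pairing} (c : σ.graph.ConnectedComponent) :
    PerfectMatching.IsComp (H := D.HalfEdge) Sigma.fst c.supp.toFinset σ := by
  refine ⟨?_, PerfectMatching.Stable.of_imp fun x hx => ?_, fun B hBc hBn hB => ?_⟩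
  · rw [Set.toFinset_nonempty]
    exact c.nonempty_supp
  · rw [Set.mem_toFinset] at hx ⊢
    -- A self-loop gives no edge of the simple graph, but then the vertex does not change.
    by_cases h : x.1 = (σ.1 x).1
    · exact h ▸ hx
    · exact c.mem_supp_of_adj_mem_supp hx ⟨h, x, rfl, rfl⟩
  · refine Finset.Subset.antisymm hBc fun w hw => ?_
    obtain ⟨v, hv⟩ := hBn
    exact mem_of_reachable hB
      (c.reachable_of_mem_supp (Set.mem_toFinset.1 (hBc hv)) (Set.mem_toFinset.1 hw)) hv

open Classical in
theorem exists_supp_eq {σ : D.Pairing} {A : Finset (Fin n)}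
    (hA : PerfectMatching.IsComp (H := D.HalfEdge) Sigma.fst A σ) :
    ∃ c : σ.graph.ConnectedComponent, c.supp.toFinset = A := by
  obtain ⟨a, ha⟩ := hA.1
  refine ⟨σ.graph.connectedComponentMk a, (isComp_supp _).eq_of_not_disjoint hA ?_⟩
  exact Finset.not_disjoint_iff.2 ⟨a, by simp, ha⟩

-- Taking supports is a bijection from connected components to minimal stable sets, and a component
-- is cyclic exactly when its support consists of vertices of degree 2.
open Classical in
theorem cycleCount_eq (σ : D.Pairing) (j : ℕ) :
    σ.cycleCount j = ((Finset.univ.filter fun i => D.deg i = 2).powerset.filter fun A =>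
      A.card = j ∧ PerfectMatching.IsComp (H := D.HalfEdge) Sigma.fst A σ).card := by
  unfold cycleCount
  rw [← Set.ncard_coe_finset, ← Set.ncard_image_of_injective (f := fun c => c.supp.toFinset)]
  · congr 1
    ext A
    simp only [Set.mem_image, Set.mem_ofPred_eq, Finset.coe_filter, Finset.mem_powerset]
    constructor
    · rintro ⟨c, ⟨hc, hj⟩, rfl⟩
      refine ⟨fun v hv => ?_, ?_, isComp_supp c⟩
      · simpa using hc v (Set.mem_toFinset.1 hv)
      · rw [← hj, Set.ncard_eq_toFinset_card']
    · rintro ⟨hA, hj, hc⟩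
      obtain ⟨c, rfl⟩ := exists_supp_eq hc
      refine ⟨c, ⟨fun v hv => ?_, ?_⟩, rfl⟩
      · simpa using hA (Set.mem_toFinset.2 hv)
      · rw [← hj, Set.ncard_eq_toFinset_card']
  · intro c d h
    exact SimpleGraph.ConnectedComponent.supp_injective (Set.toFinset_inj.1 h)

theorem sum_cycleCount (σ : D.Pairing) (W : Finset ℕ) :
    ∑ j ∈ W, σ.cycleCount j = PerfectMatching.compCount (H := D.HalfEdge) Sigma.fst W
      (Finset.univ.filter fun i => D.deg i = 2) σ := by
  classical
  unfold PerfectMatching.compCount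
  rw [Finset.card_eq_sum_card_fiberwise (f := Finset.card) (t := W)]
  · refine Finset.sum_congr rfl fun j hj => ?_
    rw [cycleCount_eq, Finset.filter_filter]
    congr 1
    ext A
    simp only [Finset.mem_filter]
    refine and_congr_right fun _ => ⟨?_, ?_⟩
    · rintro ⟨rfl, h⟩
      exact ⟨⟨hj, h⟩, rfl⟩
    · rintro ⟨⟨_, h⟩, rfl⟩
      exact ⟨rfl, h⟩
  · intro A hA
    exact (Finset.mem_filter.1 hA).2.1

end Pairing

noncomputable instance : Fintype D.Pairing :=
  inferInstanceAs (Fintype (PerfectMatching D.HalfEdge))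

theorem law_real_preimage (X : D.Pairing → ℕ) (k : ℕ) :
    (D.law.map X).real {k} =
      ((Finset.univ.filter fun σ => X σ = k).card : ℝ) / Fintype.card D.Pairing := by
  classical
  have : MeasurableSingletonClass D.Pairing := ⟨fun _ => trivial⟩
  rw [map_measureReal_apply measurable_from_top (measurableSet_singleton k), measureReal_def]
  unfold law
  rw [uniformOn_univ, ENNReal.toReal_div, ENNReal.toReal_natCast]
  congr 1
  have h : X ⁻¹' {k} = (Finset.univ.filter fun σ => X σ = k : Finset D.Pairing) := by
    ext
    simp
  rw [h, Measure.count_apply_finset]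
  simp

end DegSeq

/-! ### Asymptotics and conclusion -/

/-- From `ℓ = 2 n₂ + ℓ_{≠2}` the ratio equals `(ℓ / ℓ_{≠2} - 1) / 2`. -/
theorem tendsto_n2_div {D : (n : ℕ) → DegSeq n}
    (hratio : Tendsto (fun n => ((D n).ellNe2 : ℝ) / ((D n).ell : ℝ)) atTop (𝓝 0))
    (hinf : Tendsto (fun n => (D n).ellNe2) atTop atTop) :
    Tendsto (fun n => ((D n).n2 : ℝ) / (D n).ellNe2) atTop atTop := by
  have hpos : ∀ᶠ n in atTop, (0 : ℝ) < (D n).ellNe2 := by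
    filter_upwards [hinf.eventually_gt_atTop 0] with n hn
    exact_mod_cast hn
  have hell : ∀ n, ((D n).ell : ℝ) = 2 * (D n).n2 + (D n).ellNe2 := fun n => by
    rw [DegSeq.ell_eq]
    push_cast
    rfl
  have h1 : Tendsto (fun n => (((D n).ellNe2 : ℝ) / ((D n).ell : ℝ))⁻¹) atTop atTop := by
    refine Tendsto.inv_tendsto_nhdsGT_zero (tendsto_nhdsWithin_iff.2 ⟨hratio, ?_⟩)
    filter_upwards [hpos] with n hn
    have : (0 : ℝ) < (D n).ell := by
      rw [hell]
      positivity
    exact div_pos hn this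
  have h2 := (tendsto_atTop_add_const_right _ (-1) h1).atTop_div_const (by norm_num : (0 : ℝ) < 2)
  refine h2.congr' ?_
  filter_upwards [hpos] with n hn
  rw [inv_div, hell]
  field_simp
  ring

/-- Convergence of the binomial moments of the number of cycles in a window. -/
theorem tendsto_binomialMoment {D : (n : ℕ) → DegSeq n}
    (hratio : Tendsto (fun n => ((D n).ellNe2 : ℝ) / ((D n).ell : ℝ)) atTop (𝓝 0))
    (hinf : Tendsto (fun n => (D n).ellNe2) atTop atTop) {a t : ℝ} (ha : 0 < a) (hat : a < t)
    (k : ℕ) :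
    Tendsto (fun n => PerfectMatching.binomialMoment (H := (D n).HalfEdge) Sigma.fst
      (Finset.Icc ⌈a * ((D n).n2 / (D n).ellNe2 : ℝ)⌉₊ ⌊t * ((D n).n2 / (D n).ellNe2 : ℝ)⌋₊)
      (Finset.univ.filter fun i => (D n).deg i = 2) k) atTop
      (𝓝 ((∫ r in a..t, cycleIntensity r) ^ k / k.factorial)) := by
  have ht := ha.trans hat
  set x : ℕ → ℝ := fun n => (D n).n2 / (D n).ellNe2 with hxdef
  have hx : Tendsto x atTop atTop := tendsto_n2_div hratio hinf
  have hm : Tendsto (fun n => ((D n).ellNe2 : ℝ)) atTop atTop :=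
    tendsto_natCast_atTop_atTop.comp hinf
  -- A lower bound for the degree-2 vertices left after deleting `k` cycles from the window. As `k t
  -- x / n₂ = k t / ℓ_{≠2} → 0`, it is asymptotic to `n₂`.
  set L : ℕ → ℕ := fun n => (D n).n2 - k * ⌊t * x n⌋₊ with hL
  have hkey : ∀ᶠ n in atTop, 0 < x n ∧ (2 : ℝ) ≤ (D n).ellNe2 ∧ (0 : ℝ) < (D n).n2 ∧
      L n + k * ⌊t * x n⌋₊ = (D n).n2 ∧ 1 ≤ L n ∧
      1 - k * t / (D n).ellNe2 ≤ (L n : ℝ) / (D n).n2 := by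
    filter_upwards [hx.eventually_gt_atTop 0, hm.eventually_ge_atTop 2,
      hm.eventually_gt_atTop (k * t)] with n h1 h2 h3
    have hN : ((D n).n2 : ℝ) = x n * (D n).ellNe2 := by
      rw [hxdef]
      simp only
      rw [div_mul_cancel₀]
      linarith
    have hN0 : (0 : ℝ) < (D n).n2 := by
      rw [hN]
      positivity
    have hfl := Nat.floor_le (mul_pos ht h1).le
    have h4 : (k : ℝ) * ⌊t * x n⌋₊ ≤ k * t / (D n).ellNe2 * (D n).n2 := by
      rw [hN]
      calc (k : ℝ) * ⌊t * x n⌋₊ ≤ k * (t * x n) := by gcongr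
        _ = _ := by field_simp
    have h5 : k * ⌊t * x n⌋₊ < (D n).n2 := by
      have : (k : ℝ) * ⌊t * x n⌋₊ < (D n).n2 := by
        refine h4.trans_lt (mul_lt_of_lt_one_left hN0 ?_)
        rw [div_lt_one (by linarith)]
        exact h3
      exact_mod_cast this
    have h6 : L n + k * ⌊t * x n⌋₊ = (D n).n2 := Nat.sub_add_cancel h5.le
    refine ⟨h1, h2, hN0, h6, Nat.sub_pos_of_lt h5, ?_⟩
    have h7 : (L n : ℝ) + k * ⌊t * x n⌋₊ = (D n).n2 := by exact_mod_cast h6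
    rw [le_div_iff₀ hN0]
    linarith
  have hinv : Tendsto (fun n => ((D n).ellNe2 : ℝ)⁻¹) atTop (𝓝 0) := tendsto_inv_atTop_zero.comp hm
  have hxinv : Tendsto (fun n => (x n)⁻¹) atTop (𝓝 0) := tendsto_inv_atTop_zero.comp hx
  have hLN : Tendsto (fun n => (L n : ℝ) / (D n).n2) atTop (𝓝 1) := by
    have h1 : Tendsto (fun n => 1 - k * t / ((D n).ellNe2 : ℝ)) atTop (𝓝 1) := by
      simpa using (hm.const_div_atTop (k * t)).const_sub 1
    refine tendsto_of_tendsto_of_tendsto_of_le_of_le' h1 tendsto_const_nhds ?_ ?_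
    · filter_upwards [hkey] with n hn using hn.2.2.2.2.2
    · filter_upwards [hkey] with n hn
      rw [div_le_one hn.2.2.1]
      exact_mod_cast Nat.sub_le _ _
  -- The decay rates per vertex in the lower and upper moment bounds, multiplied by `x`, both tend
  -- to `1/2`, so the bounds share one limit.
  have hlow : Tendsto (fun n => (((D n).ellNe2 : ℝ) - 1) / (2 * L n) * x n) atTop (𝓝 (1 / 2)) := by
    have h1 := (hinv.const_sub 1).div (hLN.const_mul 2) (by norm_num)
    rw [sub_zero, mul_one] at h1
    refine h1.congr' ?_
    filter_upwards [hkey] with n ⟨_, h2, h3, _, h5, _⟩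
    have h6 : (1 : ℝ) ≤ L n := by exact_mod_cast h5
    simp only [hxdef, Pi.div_apply]
    field_simp
  have hhigh : Tendsto (fun n => (((D n).ellNe2 : ℝ) - 1) /
      (2 * (D n).n2 + (D n).ellNe2 - 1) * x n) atTop (𝓝 (1 / 2)) := by
    have h1 := (hinv.const_sub 1).div ((hxinv.mul (hinv.const_sub 1)).const_add 2) (by norm_num)
    rw [sub_zero, mul_one, add_zero] at h1
    refine h1.congr' ?_
    filter_upwards [hkey] with n ⟨_, h2, h3, _, h5, _⟩
    have h6 : (0 : ℝ) < 2 * (D n).n2 + (D n).ellNe2 - 1 := by linarith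
    have h7 : (0 : ℝ) < 2 * (D n).n2 + ((D n).ellNe2 - 1) := by linarith
    simp only [hxdef, Pi.div_apply]
    rw [add_sub_assoc]
    field_simp
  have hlo := ((tendsto_sum_exp_div ha hat hx hlow).pow k).div_const (k.factorial : ℝ)
  have hhi := ((tendsto_sum_exp_div ha hat hx hhigh).pow k).div_const (k.factorial : ℝ)
  have hsqueeze : ∀ {f g h : ℕ → ℝ} {c : ℝ}, Tendsto g atTop (𝓝 c) → Tendsto h atTop (𝓝 c) →
      (∀ᶠ n in atTop, g n ≤ f n ∧ f n ≤ h n) → Tendsto f atTop (𝓝 c) := fun hg hh h =>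
    tendsto_of_tendsto_of_tendsto_of_le_of_le' hg hh (h.mono fun _ h => h.1)
      (h.mono fun _ h => h.2)
  refine hsqueeze hlo hhi ?_
  filter_upwards [hkey] with n ⟨h1, h2, h3, h4, h5, _⟩
  obtain ⟨μ, hμ⟩ : ∃ μ, (D n).ellNe2 = 2 * μ := by
    have h := (D n).even_sum
    have h' := (D n).ell_eq
    obtain ⟨r, hr⟩ := h
    have : (D n).ell = r + r := hr
    exact ⟨r - (D n).n2, by omega⟩
  have hμ1 : 1 ≤ μ := by
    have : 2 ≤ (D n).ellNe2 := by exact_mod_cast h2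
    omega
  have := PerfectMatching.binomialMoment_bounds (H := (D n).HalfEdge)
    (W := Finset.Icc ⌈a * x n⌉₊ ⌊t * x n⌋₊) (K := ⌊t * x n⌋₊) (L := L n) (N₀ := (D n).n2) (μ := μ)
    (fun j hj => ⟨(Nat.ceil_pos.2 (mul_pos ha h1)).trans_le (Finset.mem_Icc.1 hj).1,
      (Finset.mem_Icc.1 hj).2⟩) hμ1 h5 k Sigma.fst
    (Finset.univ.filter fun i => (D n).deg i = 2)
    (fun i hi => by rw [DegSeq.card_fiber, (Finset.mem_filter.1 hi).2])
    (by rw [DegSeq.card_halfEdge, DegSeq.ell_eq, hμ, mul_add]; rfl) le_rfl h4.le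
  rw [← hμ] at this
  exact this

theorem mainTheorem3 (D : (n : ℕ) → DegSeq n)
    (hratio : Tendsto (fun n => ((D n).ellNe2 : ℝ) / ((D n).ell : ℝ)) atTop (𝓝 0))
    (hinf : Tendsto (fun n => (D n).ellNe2) atTop atTop)
    (a t : ℝ) (ha : 0 < a) (hat : a < t) :
    TendstoInDistribution
      (fun n => DegSeq.Pairing.cycleProcess (D := D n) a (t * (D n).n2 / (D n).ellNe2))
      atTop
      (id : ℕ → ℕ)
      (fun n => (D n).law)
      (poissonMeasure (∫ r in a..t, cycleIntensity r).toNNReal) := by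
  have hΛ : 0 ≤ ∫ r in a..t, cycleIntensity r :=
    intervalIntegral.integral_nonneg hat.le fun r hr => cycleIntensity_nonneg (ha.trans_le hr.1)
  refine ⟨fun n => measurable_from_top.aemeasurable, aemeasurable_id, ?_⟩
  refine tendsto_probabilityMeasure_nat fun k => ?_
  have h := tendsto_card_div_of_binomialMoments (Ω := fun n => (D n).Pairing)
    (fun n σ => PerfectMatching.compCount (H := (D n).HalfEdge) Sigma.fst
      (Finset.Icc ⌈a * ((D n).n2 / (D n).ellNe2 : ℝ)⌉₊ ⌊t * ((D n).n2 / (D n).ellNe2 : ℝ)⌋₊)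
      (Finset.univ.filter fun i => (D n).deg i = 2) σ) _
    (fun k => tendsto_binomialMoment hratio hinf ha hat k) k
  change Tendsto (fun n => ((D n).law.map (DegSeq.Pairing.cycleProcess a _)).real {k}) atTop
    (𝓝 (((poissonMeasure _).map id).real {k}))
  rw [Measure.map_id, poissonMeasure_real_singleton, Real.coe_toNNReal _ hΛ]
  refine h.congr' ?_
  -- Once `n₂ / ℓ_{≠2} > 0`, the inequality `a < t` selects the nonzero branch of `cycleProcess`.
  filter_upwards [(tendsto_n2_div hratio hinf).eventually_gt_atTop 0] with n hn
  have hX : ∀ σ : (D n).Pairing,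
      DegSeq.Pairing.cycleProcess a (t * (D n).n2 / (D n).ellNe2) σ =
      PerfectMatching.compCount (H := (D n).HalfEdge) Sigma.fst
        (Finset.Icc ⌈a * ((D n).n2 / (D n).ellNe2 : ℝ)⌉₊ ⌊t * ((D n).n2 / (D n).ellNe2 : ℝ)⌋₊)
        (Finset.univ.filter fun i => (D n).deg i = 2) σ := by
    intro σ
    unfold DegSeq.Pairing.cycleProcess
    rw [mul_div_assoc, mul_div_assoc, if_neg (not_le.2 (mul_lt_mul_of_pos_right hat hn)),
      DegSeq.Pairing.sum_cycleCount]
  rw [show DegSeq.Pairing.cycleProcess (D := D n) a (t * (D n).n2 / (D n).ellNe2) = _ from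
    funext hX]
  exact (DegSeq.law_real_preimage _ k).symm
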